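/- A set of non-negative integers is called 3-free if no three distinct elements of it form an arithmetic progression. For a non-empty finite 3-free set $A$ of non-negative integers with elements $a_0<a_1<\cdots<a_r$, the Stanley sequence $S(A)=(a_n)_{n\ge 0}$ is defined greedily: for each $n\ge r$, $a_{n+1}$ is the smallest integer greater than $a_n$ such that $\{a_0,\ldots,a_{n+1}\}$ is 3-free. The sequence $S(A)$ is called independent if there is a constant $\lambda$ such that, for all sufficiently large integers $j$, the equations $$a_{2^j+i}=a_{2^j}+a_i,\qquad a_{2^j}=2a_{2^j-1}-\lambda+1$$ hold for all $0\le i<2^j$. Theorem. Let $k$ be a positive integer, and let $T_1,T_2$ be disjoint subsets of $\{0,1,\ldots,k\}$ such that no $t\in T_1$ satisfies $t-1\in T_2$. Let $$A=\Big\{\sum_{a\in U}3^{a}+2\sum_{b\in V}3^{b}\ \Big|\ U\subseteq T_1,\ V\subseteq T_2\Big\}.$$ Then $A$ is 3-free and $S(A)$ is an independent Stanley sequence. -/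

import Mathlib

/-- The greedy sequence generated by a finite set `A` of non-negative integers: it starts with the
elements of `A` in increasing order, and each later term is the least integer that exceeds all
previous terms and keeps the set of terms free of three-term arithmetic progressions. For `A`
nonempty and 3-free the set under `sInf` is never empty (twice the last term plus one lies in
it). -/
noncomputable def stanleySeq (A : Finset ℕ) (n : ℕ) : ℕ :=
  if h : n < A.card then A.orderEmbOfFin rfl ⟨n, h⟩
  else sInf {x : ℕ | (∀ m : Fin n, stanleySeq A m < x) ∧
    ThreeAPFree (insert x (Set.range fun m : Fin n => stanleySeq A m))}
termination_by n
decreasing_by all_goals exact m.isLt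

/-- `S(A)` is an independent Stanley sequence: `A` is nonempty and 3-free (so that `S(A)` is
defined), and, for some constant `c` (the character) and all sufficiently large `k`,
`a (2 ^ k + i) = a (2 ^ k) + a i` for `0 ≤ i < 2 ^ k` and `a (2 ^ k) = 2 a (2 ^ k - 1) - c + 1`. -/
def IsIndependentStanley (A : Finset ℕ) : Prop :=
  A.Nonempty ∧ ThreeAPFree (A : Set ℕ) ∧
    ∃ c : ℤ, ∃ k₀ : ℕ, ∀ k ≥ k₀,
      (∀ i < 2 ^ k, stanleySeq A (2 ^ k + i) = stanleySeq A (2 ^ k) + stanleySeq A i) ∧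
      (stanleySeq A (2 ^ k) : ℤ) = 2 * (stanleySeq A (2 ^ k - 1) : ℤ) - c + 1

/-- The integers `∑_{a ∈ U} 3 ^ a + 2 ∑_{b ∈ V} 3 ^ b` with `U ⊆ T₁` and `V ⊆ T₂`. -/
def ternaryDigitSet (T₁ T₂ : Finset ℕ) : Finset ℕ :=
  (T₁.powerset ×ˢ T₂.powerset).image
    fun p => ∑ a ∈ p.1, 3 ^ a + 2 * ∑ b ∈ p.2, 3 ^ b

/-! `T₁` and `T₂` are read as a word over the ternary positions, lowest first, and the candidate set
`Term w` is built by recursion on it. A marked position carries the digits 0, 1 or the digits 0, 2;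
a free position carries 0 over the old terms and 1 over `top w + c`, where c has digits 0 and 1
only. `Term w` is 3-free, and its elements up to `top w` form A. Once every other integer above `top
w` is known to end a progression in `Term w`, the greedy sequence must enumerate `Term w`
(`stanleySeq_eq_nth`). Independence then holds because, for large k, `Term w` has 2 ^ k elements
below 3 ^ k (`count_term`) and that block repeats after translation by 3 ^ k (`term_pow_add_iff`).

The hard point is the covering, `term_or_exists_progression`, at z = 3 (`top w` + q) + 2 over a free
position. The last digits of the progression must be 0, 1, 2 or 1, 0, 2, which leads to `Below 0 q`
or `Above 1 0 q`. `below_or_above` shows by induction that one of them occurs. Since a `two` shifts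
the offsets, five further alternatives are carried along for words not starting with `one`; this is
where the condition on `T₁` and `T₂` enters. -/

/-! ### Numbers with ternary digits 0 and 1. -/

/-- Natural numbers whose ternary digits are all `0` or `1`. -/
inductive TernaryZeroOne : ℕ → Prop
  | zero : TernaryZeroOne 0
  | three_mul {n : ℕ} : TernaryZeroOne n → TernaryZeroOne (3 * n)
  | three_mul_add_one {n : ℕ} : TernaryZeroOne n → TernaryZeroOne (3 * n + 1)

namespace TernaryZeroOne

theorem three_mul_iff {n : ℕ} : TernaryZeroOne (3 * n) ↔ TernaryZeroOne n := by
  refine ⟨fun h => ?_, three_mul⟩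
  generalize hm : 3 * n = m at h
  cases h with
  | zero => obtain rfl : n = 0 := by omega
            exact zero
  | three_mul h => obtain rfl := Nat.eq_of_mul_eq_mul_left (by norm_num) hm
                   exact h
  | three_mul_add_one h => omega

theorem three_mul_add_one_iff {n : ℕ} : TernaryZeroOne (3 * n + 1) ↔ TernaryZeroOne n := by
  refine ⟨fun h => ?_, three_mul_add_one⟩
  generalize hm : 3 * n + 1 = m at h
  cases h with
  | zero => omega
  | three_mul h => omega
  | @three_mul_add_one a h => obtain rfl : n = a := by omega
                              exact h

theorem not_three_mul_add_two {n : ℕ} : ¬ TernaryZeroOne (3 * n + 2) := by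
  intro h
  generalize hm : 3 * n + 2 = m at h
  cases h <;> omega

theorem exists_eq_three_mul {n : ℕ} (h : TernaryZeroOne n) :
    ∃ m, TernaryZeroOne m ∧ (n = 3 * m ∨ n = 3 * m + 1) := by
  cases h with
  | zero => exact ⟨0, zero, .inl rfl⟩
  | three_mul h => exact ⟨_, h, .inl rfl⟩
  | three_mul_add_one h => exact ⟨_, h, .inr rfl⟩

/-- Every natural number is `2 c - s` with `s ≤ c` both having digits `0` and `1` only. -/
theorem exists_add_eq_two_mul (q : ℕ) :
    ∃ c s, TernaryZeroOne c ∧ TernaryZeroOne s ∧ s ≤ c ∧ q + s = 2 * c := by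
  induction q using Nat.strong_induction_on with
  | _ q ih =>
    rcases Nat.eq_zero_or_pos q with rfl | hq
    · exact ⟨0, 0, zero, zero, le_rfl, rfl⟩
    obtain ⟨c, s, hc, hs, hsc, h⟩ := ih (q / 3) (by omega)
    -- No carries arise: the digits satisfy 0 = 2·0 - 0, 1 = 2·1 - 1, 2 = 2·1 - 0.
    have hr : q % 3 = 0 ∨ q % 3 = 1 ∨ q % 3 = 2 := by omega
    rcases hr with hr | hr | hr
    · exact ⟨_, _, hc.three_mul, hs.three_mul, by omega, by omega⟩
    · exact ⟨_, _, hc.three_mul_add_one, hs.three_mul_add_one, by omega, by omega⟩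
    · exact ⟨_, _, hc.three_mul_add_one, hs.three_mul, by omega, by omega⟩

theorem exists_add_eq_two_mul_of_not {q : ℕ} (hq : ¬ TernaryZeroOne q) :
    ∃ c s, TernaryZeroOne c ∧ TernaryZeroOne s ∧ s < c ∧ q + s = 2 * c := by
  obtain ⟨c, s, hc, hs, hsc, h⟩ := exists_add_eq_two_mul q
  refine ⟨c, s, hc, hs, lt_of_le_of_ne hsc ?_, h⟩
  rintro rfl
  exact hq ((by omega : q = s) ▸ hs)

theorem two_mul_lt {n k : ℕ} (h : TernaryZeroOne n) (hn : n < 3 ^ k) : 2 * n < 3 ^ k := by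
  induction k generalizing n with
  | zero => omega
  | succ k ih =>
    rw [pow_succ] at hn ⊢
    obtain ⟨m, hm, rfl | rfl⟩ := h.exists_eq_three_mul <;> have := ih hm (by omega) <;> omega

/-- Neither sum carries, and y + y has digits 0 and 2 only, so x and z agree with y in every digit.
-/
theorem eq_of_add_eq {x y z : ℕ} (hx : TernaryZeroOne x) (hy : TernaryZeroOne y)
    (hz : TernaryZeroOne z) (h : x + z = y + y) : x = y := by
  induction hx generalizing y z with
  | zero =>
    have key : ∀ y, ∀ z, TernaryZeroOne y → TernaryZeroOne z → z = y + y → y = 0 := by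
      intro y
      induction y using Nat.strong_induction_on with
      | _ y ih =>
        intro z hy hz hyz
        by_contra hne
        obtain ⟨y', hy', rfl | rfl⟩ := hy.exists_eq_three_mul <;>
        obtain ⟨z', hz', rfl | rfl⟩ := hz.exists_eq_three_mul <;> try omega
        have := ih y' (by omega) z' hy' hz' (by omega)
        omega
    exact (key y z hy hz (by omega)).symm
  | three_mul hx ih =>
    obtain ⟨y', hy', rfl | rfl⟩ := hy.exists_eq_three_mul <;>
    obtain ⟨z', hz', rfl | rfl⟩ := hz.exists_eq_three_mul <;> try omega
    rw [ih hy' hz' (by omega)]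
  | three_mul_add_one hx ih =>
    obtain ⟨y', hy', rfl | rfl⟩ := hy.exists_eq_three_mul <;>
    obtain ⟨z', hz', rfl | rfl⟩ := hz.exists_eq_three_mul <;> try omega
    rw [ih hy' hz' (by omega)]

theorem lt_pow_succ_iff {n k : ℕ} : TernaryZeroOne n ∧ n < 3 ^ (k + 1) ↔
    (TernaryZeroOne n ∧ n < 3 ^ k) ∨ ∃ m, TernaryZeroOne m ∧ m < 3 ^ k ∧ n = 3 ^ k + m := by
  induction k generalizing n with
  | zero =>
    constructor
    · rintro ⟨h, hn⟩
      have : n = 0 ∨ n = 1 ∨ n = 2 := by omega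
      rcases this with rfl | rfl | rfl
      · exact .inl ⟨h, by norm_num⟩
      · exact .inr ⟨0, zero, by norm_num, by norm_num⟩
      · exact absurd h (not_three_mul_add_two (n := 0))
    · rintro (⟨h, hn⟩ | ⟨m, hm, hlt, rfl⟩)
      · exact ⟨h, by omega⟩
      · obtain rfl : m = 0 := by omega
        exact ⟨three_mul_add_one zero, by norm_num⟩
  | succ k ih =>
    have e1 : 3 ^ (k + 1 + 1) = 3 * 3 ^ (k + 1) := by ring
    have e2 : 3 ^ (k + 1) = 3 * 3 ^ k := by ring
    constructor
    · rintro ⟨h, hn⟩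
      obtain ⟨m, hm, rfl | rfl⟩ := h.exists_eq_three_mul
      · rcases ih.1 ⟨hm, by omega⟩ with ⟨_, hlt⟩ | ⟨a, ha, hlt, rfl⟩
        · exact .inl ⟨h, by omega⟩
        · exact .inr ⟨_, ha.three_mul, by omega, by omega⟩
      · rcases ih.1 ⟨hm, by omega⟩ with ⟨_, hlt⟩ | ⟨a, ha, hlt, rfl⟩
        · exact .inl ⟨h, by omega⟩
        · exact .inr ⟨_, ha.three_mul_add_one, by omega, by omega⟩
    · rintro (⟨h, hn⟩ | ⟨m, hm, hlt, rfl⟩)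
      · exact ⟨h, by omega⟩
      · obtain ⟨a, ha, rfl | rfl⟩ := hm.exists_eq_three_mul
        · have := (ih (n := 3 ^ k + a)).2 (.inr ⟨a, ha, by omega, rfl⟩)
          refine ⟨?_, by omega⟩
          convert this.1.three_mul using 1
          omega
        · have := (ih (n := 3 ^ k + a)).2 (.inr ⟨a, ha, by omega, rfl⟩)
          refine ⟨?_, by omega⟩
          convert this.1.three_mul_add_one using 1
          omega

end TernaryZeroOne

/-! ### Digit words and the candidate set of terms. -/

/-- A finite word prescribing, from the lowest ternary position upwards, whether the position
carries no generator (`free`), the generator `3 ^ t` (`one`) or the generator `2 * 3 ^ t`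
(`two`). -/
inductive DigitWord : Type
  | nil : DigitWord
  | free : DigitWord → DigitWord
  | one : DigitWord → DigitWord
  | two : DigitWord → DigitWord

namespace DigitWord

/-- The number of positions prescribed by a word. -/
def length : DigitWord → ℕ
  | nil => 0
  | free w => length w + 1
  | one w => length w + 1
  | two w => length w + 1

/-- The lowest position is marked `one`. -/
def StartsWithOne : DigitWord → Prop
  | one _ => True
  | _ => False

/-- No position marked `two` is directly below a position marked `one`. -/
def Admissible : DigitWord → Prop
  | nil => True
  | free w => Admissible w
  | one w => Admissible w
  | two w => Admissible w ∧ ¬ StartsWithOne w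

/-- The largest element generated by a word. -/
def top : DigitWord → ℕ
  | nil => 0
  | free w => 3 * top w
  | one w => 3 * top w + 1
  | two w => 3 * top w + 2

/-- The numbers generated by a word. -/
def Gen : DigitWord → ℕ → Prop
  | nil, n => n = 0
  | free w, n => ∃ m, Gen w m ∧ n = 3 * m
  | one w, n => ∃ m, Gen w m ∧ (n = 3 * m ∨ n = 3 * m + 1)
  | two w, n => ∃ m, Gen w m ∧ (n = 3 * m ∨ n = 3 * m + 2)

/-- The terms of the Stanley sequence of the numbers generated by a word. -/
def Term : DigitWord → ℕ → Prop
  | nil, n => TernaryZeroOne n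
  | free w, n => (∃ m, Term w m ∧ n = 3 * m) ∨
      ∃ c, TernaryZeroOne c ∧ n = 3 * (top w + c) + 1
  | one w, n => ∃ m, Term w m ∧ (n = 3 * m ∨ n = 3 * m + 1)
  | two w, n => ∃ m, Term w m ∧ (n = 3 * m ∨ n = 3 * m + 2)

theorem top_lt (w : DigitWord) : w.top < 3 ^ w.length := by
  induction w with
  | nil => simp [top, length]
  | free w ih => simp only [top, length, pow_succ]; omega
  | one w ih => simp only [top, length, pow_succ]; omega
  | two w ih => simp only [top, length, pow_succ]; omega

theorem gen_iff (w : DigitWord) (n : ℕ) : w.Gen n ↔ w.Term n ∧ n ≤ w.top := by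
  induction w generalizing n with
  | nil =>
    simp only [Gen, Term, top]
    constructor
    · rintro rfl; exact ⟨.zero, le_rfl⟩
    · rintro ⟨_, h⟩; omega
  | free w ih =>
    simp only [Gen, Term, top, ih]
    constructor
    · rintro ⟨m, ⟨hm, hle⟩, rfl⟩; exact ⟨.inl ⟨m, hm, rfl⟩, by omega⟩
    · rintro ⟨⟨m, hm, rfl⟩ | ⟨c, hc, rfl⟩, hle⟩
      · exact ⟨m, ⟨hm, by omega⟩, rfl⟩
      · omega
  | one w ih =>
    simp only [Gen, Term, top, ih]
    constructor
    · rintro ⟨m, ⟨hm, hle⟩, h⟩; exact ⟨⟨m, hm, h⟩, by omega⟩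
    · rintro ⟨⟨m, hm, h⟩, hle⟩; exact ⟨m, ⟨hm, by omega⟩, h⟩
  | two w ih =>
    simp only [Gen, Term, top, ih]
    constructor
    · rintro ⟨m, ⟨hm, hle⟩, h⟩; exact ⟨⟨m, hm, h⟩, by omega⟩
    · rintro ⟨⟨m, hm, h⟩, hle⟩; exact ⟨m, ⟨hm, by omega⟩, h⟩

theorem gen_top (w : DigitWord) : w.Gen w.top := by
  induction w with
  | nil => rfl
  | free w ih => exact ⟨_, ih, rfl⟩
  | one w ih => exact ⟨_, ih, .inr rfl⟩
  | two w ih => exact ⟨_, ih, .inr rfl⟩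

theorem term_top (w : DigitWord) : w.Term w.top := ((gen_iff w _).1 (gen_top w)).1

theorem term_zero (w : DigitWord) : w.Term 0 := by
  induction w with
  | nil => exact .zero
  | free w ih => exact .inl ⟨0, ih, rfl⟩
  | one w ih => exact ⟨0, ih, .inl rfl⟩
  | two w ih => exact ⟨0, ih, .inl rfl⟩

theorem threeAPFree_term (w : DigitWord) : ThreeAPFree {n | w.Term n} := by
  suffices H : ∀ x y z, w.Term x → w.Term y → w.Term z → x + z = y + y → x = y from
    fun x hx y hy z hz h => H x y z hx hy hz h
  induction w with
  | nil => exact fun x y z hx hy hz h => TernaryZeroOne.eq_of_add_eq hx hy hz h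
  | free w ih =>
    rintro x y z (⟨x, hx, rfl⟩ | ⟨x, hx, rfl⟩) (⟨y, hy, rfl⟩ | ⟨y, hy, rfl⟩)
      (⟨z, hz, rfl⟩ | ⟨z, hz, rfl⟩) h <;> try omega
    · rw [ih x y z hx hy hz (by omega)]
    · rw [TernaryZeroOne.eq_of_add_eq hx hy hz (by omega)]
  | one w ih =>
    rintro x y z ⟨x, hx, rfl | rfl⟩ ⟨y, hy, rfl | rfl⟩ ⟨z, hz, rfl | rfl⟩ h <;> try omega
    all_goals rw [ih x y z hx hy hz (by omega)]
  | two w ih =>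
    rintro x y z ⟨x, hx, rfl | rfl⟩ ⟨y, hy, rfl | rfl⟩ ⟨z, hz, rfl | rfl⟩ h <;> try omega
    all_goals rw [ih x y z hx hy hz (by omega)]

/-! ### Progressions mixing the digits 0 and 1 of a free position. -/

/-- `r` is a term relative to the largest generated element. -/
def RelTerm (w : DigitWord) (r : ℤ) : Prop := ∃ s : ℕ, w.Term s ∧ (s : ℤ) = w.top + r

/-- The subtracted 0 lets `Below.lift` and `Above.lift` find the drop e by unification. -/
theorem RelTerm.free {w : DigitWord} {r : ℤ} (h : w.RelTerm r) : w.free.RelTerm (3 * r - 0) := by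
  obtain ⟨s, hs, e⟩ := h
  exact ⟨3 * s, .inl ⟨s, hs, rfl⟩, by simp only [top]; push_cast; omega⟩

theorem relTerm_free_add_one (w : DigitWord) {c : ℕ} (hc : TernaryZeroOne c) :
    w.free.RelTerm (3 * c + 1) :=
  ⟨3 * (w.top + c) + 1, .inr ⟨c, hc, rfl⟩, by simp only [top]; push_cast; ring⟩

theorem RelTerm.one {w : DigitWord} {r : ℤ} (h : w.RelTerm r) : w.one.RelTerm (3 * r - 0) := by
  obtain ⟨s, hs, e⟩ := h
  exact ⟨3 * s + 1, ⟨s, hs, .inr rfl⟩, by simp only [top]; push_cast; omega⟩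

theorem RelTerm.one_sub {w : DigitWord} {r : ℤ} (h : w.RelTerm r) :
    w.one.RelTerm (3 * r - 1) := by
  obtain ⟨s, hs, e⟩ := h
  exact ⟨3 * s, ⟨s, hs, .inl rfl⟩, by simp only [top]; push_cast; omega⟩

theorem RelTerm.two {w : DigitWord} {r : ℤ} (h : w.RelTerm r) : w.two.RelTerm (3 * r - 0) := by
  obtain ⟨s, hs, e⟩ := h
  exact ⟨3 * s + 2, ⟨s, hs, .inr rfl⟩, by simp only [top]; push_cast; omega⟩

theorem RelTerm.two_sub {w : DigitWord} {r : ℤ} (h : w.RelTerm r) :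
    w.two.RelTerm (3 * r - 2) := by
  obtain ⟨s, hs, e⟩ := h
  exact ⟨3 * s, ⟨s, hs, .inl rfl⟩, by simp only [top]; push_cast; omega⟩

theorem relTerm_nil {c : ℕ} (hc : TernaryZeroOne c) : nil.RelTerm c := ⟨c, hc, by simp [top]⟩

/-- `2 c - q + i` is a relative term for some `c ≤ q` with digits `0` and `1`. -/
def Below (w : DigitWord) (i : ℤ) (q : ℕ) : Prop :=
  ∃ c : ℕ, TernaryZeroOne c ∧ c ≤ q ∧ w.RelTerm (2 * c - q + i)

/-- `(q + c + j) / 2` is a relative term for some `c ≤ q - t` with digits `0` and `1`. -/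
def Above (w : DigitWord) (j : ℤ) (t q : ℕ) : Prop :=
  ∃ c : ℕ, TernaryZeroOne c ∧ c + t ≤ q ∧ ∃ s : ℤ, w.RelTerm s ∧ q + c + j = 2 * s

/-- Adding a lowest position sends r to 3 r - e and c to 3 c + g; `he` balances the offsets. The
side conditions are found automatically, so a caller chooses only the digit g. -/
theorem Below.lift {w v : DigitWord} {e i' : ℤ} {q : ℕ} (h : w.Below i' q)
    (hv : ∀ {r}, w.RelTerm r → v.RelTerm (3 * r - e)) {i : ℤ} {n : ℕ} (g : ℕ)
    (hg : g = 0 ∨ g = 1 := by simp) (hgn : 3 * q + g ≤ n := by omega)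
    (he : 3 * i' - e = 2 * g - (n - 3 * q : ℤ) + i := by omega) : v.Below i n := by
  obtain ⟨c, hc, hcq, hR⟩ := h
  refine ⟨3 * c + g, ?_, by omega, ?_⟩
  · rcases hg with rfl | rfl
    exacts [hc.three_mul, hc.three_mul_add_one]
  · convert hv hR using 1
    push_cast
    linarith

theorem Above.lift {w v : DigitWord} {e j' : ℤ} {t' q : ℕ} (h : w.Above j' t' q)
    (hv : ∀ {r}, w.RelTerm r → v.RelTerm (3 * r - e)) {j : ℤ} {t n : ℕ} (g : ℕ)
    (hg : g = 0 ∨ g = 1 := by simp) (hgn : 3 * q + g + t ≤ n + 3 * t' := by omega)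
    (he : 3 * j' - 2 * e = (n - 3 * q : ℤ) + g + j := by omega) : v.Above j t n := by
  obtain ⟨c, hc, hcq, s, hR, hs⟩ := h
  refine ⟨3 * c + g, ?_, by omega, _, hv hR, ?_⟩
  · rcases hg with rfl | rfl
    exacts [hc.three_mul, hc.three_mul_add_one]
  · push_cast
    linarith

theorem exists_eq_three_mul_add (q : ℕ) :
    ∃ m, q = 3 * m ∨ q = 3 * m + 1 ∨ q = 3 * m + 2 := ⟨q / 3, by omega⟩

theorem below_nil_zero (q : ℕ) : nil.Below 0 q := by
  obtain ⟨c, s, hc, hs, hsc, h⟩ := TernaryZeroOne.exists_add_eq_two_mul q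
  refine ⟨c, hc, by omega, ?_⟩
  convert relTerm_nil hs using 1
  omega

theorem below_nil_one (q : ℕ) : nil.Below 1 q := by
  rcases q with _ | q
  · exact ⟨0, .zero, le_rfl, by simpa using relTerm_nil (.three_mul_add_one .zero)⟩
  obtain ⟨c, s, hc, hs, hsc, h⟩ := TernaryZeroOne.exists_add_eq_two_mul q
  refine ⟨c, hc, by omega, ?_⟩
  convert relTerm_nil hs using 1
  push_cast
  omega

/-- The digit-1 terms of `free w` lie at 3 s + 1 relative to the top, for every s with digits 0 and
1, so nothing about w is needed. -/
theorem below_free_of_three_mul (w : DigitWord) {i : ℤ} {n : ℕ} (q : ℕ) (g : ℕ)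
    (hg : g = 0 ∨ g = 1 := by simp) (hgn : 3 * q + g ≤ n := by omega)
    (he : 1 = 2 * g - (n - 3 * q : ℤ) + i := by omega) : w.free.Below i n := by
  obtain ⟨c, s, hc, hs, hsc, h⟩ := TernaryZeroOne.exists_add_eq_two_mul q
  refine ⟨3 * c + g, ?_, by omega, ?_⟩
  · rcases hg with rfl | rfl
    exacts [hc.three_mul, hc.three_mul_add_one]
  · convert relTerm_free_add_one w hs using 1
    push_cast
    omega

/-- For q with digits 0 and 1, q + c = 2 s forces c = s = q, so no solution with c < q exists and
progressions from below must serve instead. -/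
theorem below_zero_and_below_one (w : DigitWord) (hw : w.Admissible) {q : ℕ}
    (hq : TernaryZeroOne q) : w.Below 0 q ∧ (¬ w.StartsWithOne → w.Below 1 q) := by
  induction w generalizing q with
  | nil => exact ⟨below_nil_zero q, fun _ => below_nil_one q⟩
  | free w ih =>
    obtain ⟨q, hq', rfl | rfl⟩ := hq.exists_eq_three_mul
    · exact ⟨(ih hw hq').1.lift .free 0,
        fun _ => below_free_of_three_mul w q 0⟩
    · exact ⟨below_free_of_three_mul w q 1,
        fun _ => (ih hw hq').1.lift .free 0⟩
  | one w ih =>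
    obtain ⟨q, hq', rfl | rfl⟩ := hq.exists_eq_three_mul
    · exact ⟨(ih hw hq').1.lift .one 0,
        fun h => absurd trivial h⟩
    · exact ⟨(ih hw hq').1.lift .one_sub 0,
        fun h => absurd trivial h⟩
  | two w ih =>
    obtain ⟨q, hq', rfl | rfl⟩ := hq.exists_eq_three_mul
    · exact ⟨(ih hw.1 hq').1.lift .two 0,
        fun _ => ((ih hw.1 hq').2 hw.2).lift .two_sub 0⟩
    · exact ⟨((ih hw.1 hq').2 hw.2).lift .two_sub 1,
        fun _ => (ih hw.1 hq').1.lift .two 0⟩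

theorem below_zero_of_succ (w : DigitWord) (hw : w.Admissible) {q : ℕ}
    (hq : TernaryZeroOne (q + 1)) : w.Below 0 q := by
  -- Subtracting 1 turns trailing zeros of q + 1 into digits 2, which are stripped one at a time.
  have key : ∀ q, TernaryZeroOne (q + 1) → TernaryZeroOne q ∨
      ∃ p, TernaryZeroOne (p + 1) ∧ q = 3 * p + 2 := by
    intro q hq
    obtain ⟨m, hm, h | h⟩ := hq.exists_eq_three_mul
    · obtain ⟨p, rfl⟩ : ∃ p, m = p + 1 := ⟨m - 1, by omega⟩
      exact .inr ⟨p, hm, by omega⟩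
    · obtain rfl : q = 3 * m := by omega
      exact .inl hm.three_mul
  induction w generalizing q with
  | nil => exact below_nil_zero _
  | free w ih =>
    rcases key q hq with h | ⟨p, hp, rfl⟩
    · exact (below_zero_and_below_one _ hw h).1
    · exact (ih hw hp).lift .free 1
  | one w ih =>
    rcases key q hq with h | ⟨p, hp, rfl⟩
    · exact (below_zero_and_below_one _ hw h).1
    · exact (ih hw hp).lift .one 1
  | two w ih =>
    rcases key q hq with h | ⟨p, hp, rfl⟩
    · exact (below_zero_and_below_one _ hw h).1
    · exact (ih hw.1 hp).lift .two 1

/-- A solution of `p + c = 2 s` with `c` and `s` having digits `0` and `1` provides a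
relative term of `free w` above. -/
theorem above_free (w : DigitWord) {j : ℤ} {t n p c s : ℕ} (hc : TernaryZeroOne c)
    (hs : TernaryZeroOne s) (h : p + c = 2 * s) (g : ℕ) (hg : g = 0 ∨ g = 1 := by simp)
    (hle : 3 * c + g + t ≤ n := by omega)
    (he : (n : ℤ) + g + j = 3 * p + 2 := by omega) : w.free.Above j t n := by
  refine ⟨3 * c + g, ?_, hle, _, relTerm_free_add_one w hs, ?_⟩
  · rcases hg with rfl | rfl
    exacts [hc.three_mul, hc.three_mul_add_one]
  · push_cast
    omega

/-- For `w` admissible, every `q` is reached from below or from above; if `w` does not start with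
`one`, this also holds for shifted offsets. -/
theorem below_or_above (w : DigitWord) (hw : w.Admissible) :
    (∀ q, w.Below 0 q ∨ w.Above 1 0 q) ∧ (¬ w.StartsWithOne →
      (∀ q, w.Below 0 q ∨ w.Above 2 1 q) ∧ (∀ q, w.Below 0 q ∨ w.Above 3 0 q) ∧
      (∀ q, w.Below 1 q ∨ w.Above 1 0 q) ∧ (∀ q, w.Below 1 q ∨ w.Above 2 1 q) ∧
      (∀ q, w.Below 1 q ∨ w.Above 3 0 q)) := by
  induction w with
  | nil =>
    exact ⟨fun q => .inl (below_nil_zero q), fun _ => ⟨fun q => .inl (below_nil_zero q),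
      fun q => .inl (below_nil_zero q), fun q => .inl (below_nil_one q),
      fun q => .inl (below_nil_one q), fun q => .inl (below_nil_one q)⟩⟩
  | free w ih =>
    have h01 := (ih hw).1
    have hself : ∀ q, w.Below 0 q ∨ ∃ c s, TernaryZeroOne c ∧ TernaryZeroOne s ∧ c < q ∧
        q + c = 2 * s := by
      intro q
      by_cases hq : TernaryZeroOne q
      · exact .inl (below_zero_and_below_one w hw hq).1
      · obtain ⟨s, c, hs, hc, hlt, h⟩ := TernaryZeroOne.exists_add_eq_two_mul_of_not hq
        exact .inr ⟨c, s, hc, hs, by omega, h⟩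
    have hsucc : ∀ q, w.Below 0 q ∨ ∃ c s, TernaryZeroOne c ∧ TernaryZeroOne s ∧ c ≤ q ∧
        (q + 1) + c = 2 * s := by
      intro q
      by_cases hq : TernaryZeroOne (q + 1)
      · exact .inl (below_zero_of_succ w hw hq)
      · obtain ⟨s, c, hs, hc, hlt, h⟩ := TernaryZeroOne.exists_add_eq_two_mul_of_not hq
        exact .inr ⟨c, s, hc, hs, by omega, h⟩
    have h0 : ∀ q, w.free.Below 0 (3 * q + 1) := fun q => below_free_of_three_mul w q 1
    have h1 : ∀ q, w.free.Below 1 (3 * q) := fun q => below_free_of_three_mul w q 0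
    have h1' : ∀ q, w.free.Below 1 (3 * q + 2) := fun q => below_free_of_three_mul w q 1
    refine ⟨fun q => ?_, fun _ => ⟨fun q => ?_, fun q => ?_, fun q => ?_, fun q => ?_,
      fun q => ?_⟩⟩ <;>
      obtain ⟨q, rfl | rfl | rfl⟩ := exists_eq_three_mul_add q
    · rcases hself q with h | ⟨c, s, hc, hs, hlt, h⟩
      exacts [.inl (h.lift .free 0), .inr (above_free w hc hs h 1)]
    · exact .inl (h0 q)
    · exact (h01 q).imp (fun h => h.lift .free 1) fun h => h.lift .free 0
    · rcases hself q with h | ⟨c, s, hc, hs, hlt, h⟩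
      exacts [.inl (h.lift .free 0), .inr (above_free w hc hs h 0)]
    · exact .inl (h0 q)
    · rcases hsucc q with h | ⟨c, s, hc, hs, hlt, h⟩
      exacts [.inl (h.lift .free 1), .inr (above_free w hc hs h 1)]
    · exact (h01 q).imp (fun h => h.lift .free 0) fun h => h.lift .free 0
    · exact .inl (h0 q)
    · rcases hsucc q with h | ⟨c, s, hc, hs, hlt, h⟩
      exacts [.inl (h.lift .free 1), .inr (above_free w hc hs h 0)]
    · exact .inl (h1 q)
    · obtain ⟨s, c, hs, hc, hle, h⟩ := TernaryZeroOne.exists_add_eq_two_mul q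
      exact .inr (above_free w hc hs h 0)
    · exact .inl (h1' q)
    · exact .inl (h1 q)
    · exact (h01 q).imp (fun h => h.lift .free 0) fun h => h.lift .free 0
    · exact .inl (h1' q)
    · exact .inl (h1 q)
    · rcases hsucc q with h | ⟨c, s, hc, hs, hlt, h⟩
      exacts [.inl (h.lift .free 0), .inr (above_free w hc hs h 1)]
    · exact .inl (h1' q)
  | one w ih =>
    refine ⟨fun q => ?_, fun h => absurd trivial h⟩
    -- The drops 0 and 1 always lead back to the offsets 0 and 1, so this case needs no shifted
    -- alternative.
    obtain ⟨q, rfl | rfl | rfl⟩ := exists_eq_three_mul_add q <;>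
      rcases (ih hw).1 q with h | h
    · exact .inl (h.lift .one 0)
    · exact .inr (h.lift .one_sub 0)
    · exact .inl (h.lift .one_sub 0)
    · exact .inr (h.lift .one 1)
    · exact .inl (h.lift .one 1)
    · exact .inr (h.lift .one 0)
  | two w ih =>
    obtain ⟨h01, h⟩ := ih hw.1
    obtain ⟨h02, h03, h11, h12, h13⟩ := h hw.2
    refine ⟨fun q => ?_, fun _ => ⟨fun q => ?_, fun q => ?_, fun q => ?_, fun q => ?_,
      fun q => ?_⟩⟩ <;>
      obtain ⟨q, rfl | rfl | rfl⟩ := exists_eq_three_mul_add q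
    -- The slack t = 1 makes room for the new digit g = 1: the bound 3 c + 1 ≤ 3 q requires c < q.
    · exact (h02 q).imp (fun h => h.lift .two 0) fun h => h.lift .two_sub 1
    · exact (h11 q).imp (fun h => h.lift .two_sub 1) fun h => h.lift .two 1
    · exact (h01 q).imp (fun h => h.lift .two 1) fun h => h.lift .two 0
    · exact (h02 q).imp (fun h => h.lift .two 0) fun h => h.lift .two_sub 0
    · exact (h11 q).imp (fun h => h.lift .two_sub 1) fun h => h.lift .two 0
    · exact (h03 q).imp (fun h => h.lift .two 1) fun h => h.lift .two_sub 1
    · exact (h01 q).imp (fun h => h.lift .two 0) fun h => h.lift .two 0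
    · exact (h13 q).imp (fun h => h.lift .two_sub 1) fun h => h.lift .two_sub 1
    · exact (h03 q).imp (fun h => h.lift .two 1) fun h => h.lift .two_sub 0
    · exact (h12 q).imp (fun h => h.lift .two_sub 0) fun h => h.lift .two_sub 1
    · exact (h01 q).imp (fun h => h.lift .two 0) fun h => h.lift .two 1
    · exact (h11 q).imp (fun h => h.lift .two_sub 1) fun h => h.lift .two 0
    · exact (h12 q).imp (fun h => h.lift .two_sub 0) fun h => h.lift .two_sub 0
    · exact (h01 q).imp (fun h => h.lift .two 0) fun h => h.lift .two 0
    · exact (h13 q).imp (fun h => h.lift .two_sub 1) fun h => h.lift .two_sub 1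
    · exact (h11 q).imp (fun h => h.lift .two_sub 0) fun h => h.lift .two 0
    · exact (h03 q).imp (fun h => h.lift .two 0) fun h => h.lift .two_sub 1
    · exact (h13 q).imp (fun h => h.lift .two_sub 1) fun h => h.lift .two_sub 0

end DigitWord

/-! ### Covering the integers above the generated set. -/

namespace DigitWord

/-- Every non-term above the generated set completes an arithmetic progression of terms. -/
theorem term_or_exists_progression (w : DigitWord) (hw : w.Admissible) {z : ℕ} (hz : w.top < z) :
    w.Term z ∨ ∃ x y, w.Term x ∧ w.Term y ∧ x < y ∧ x + z = y + y := by
  induction w generalizing z with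
  | nil =>
    obtain ⟨c, s, hc, hs, hsc, h⟩ := TernaryZeroOne.exists_add_eq_two_mul z
    rcases hsc.eq_or_lt with rfl | hlt
    · obtain rfl : z = s := by omega
      exact .inl hs
    · exact .inr ⟨s, c, hs, hc, hlt, by omega⟩
  | free w ih =>
    simp only [top] at hz
    obtain ⟨z, rfl | rfl | rfl⟩ := exists_eq_three_mul_add z
    · rcases ih hw (z := z) (by omega) with h | ⟨x, y, hx, hy, hlt, h⟩
      · exact .inl (.inl ⟨z, h, rfl⟩)
      · exact .inr ⟨3 * x, 3 * y, .inl ⟨x, hx, rfl⟩, .inl ⟨y, hy, rfl⟩, by omega, by omega⟩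
    · obtain ⟨q, rfl⟩ : ∃ q, z = w.top + q := ⟨z - w.top, by omega⟩
      obtain ⟨c, s, hc, hs, hsc, h⟩ := TernaryZeroOne.exists_add_eq_two_mul q
      rcases hsc.eq_or_lt with rfl | hlt
      · obtain rfl : q = s := by omega
        exact .inl (.inr ⟨q, hs, rfl⟩)
      · exact .inr ⟨_, _, .inr ⟨s, hs, rfl⟩, .inr ⟨c, hc, rfl⟩, by omega, by omega⟩
    · obtain ⟨q, rfl⟩ : ∃ q, z = w.top + q := ⟨z - w.top, by omega⟩
      -- The last digits of the progression are 0, 1, 2 in the first case and 1, 0, 2 in the second.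
      rcases (below_or_above w hw).1 q with ⟨c, hc, hcq, s, hs, e⟩ | ⟨c, hc, hcq, r, ⟨s, hs, e⟩, h⟩
      · exact .inr ⟨_, _, .inl ⟨s, hs, rfl⟩, .inr ⟨c, hc, rfl⟩, by omega, by omega⟩
      · exact .inr ⟨_, _, .inr ⟨c, hc, rfl⟩, .inl ⟨s, hs, rfl⟩, by omega, by omega⟩
  | one w ih =>
    simp only [top] at hz
    obtain ⟨m, e, hm, rfl, he⟩ : ∃ m e, w.top ≤ m ∧ z = 3 * m + e ∧
        (e = 0 ∨ e = 1 ∨ e = 2) := ⟨z / 3, z % 3, by omega, by omega, by omega⟩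
    have key : w.Term m ∨ ∃ x y, w.Term x ∧ w.Term y ∧ x < y ∧ x + m = y + y := by
      rcases hm.eq_or_lt with rfl | hlt
      exacts [.inl w.term_top, ih hw hlt]
    rcases key with h | ⟨x, y, hx, hy, hlt, h⟩ <;> rcases he with rfl | rfl | rfl
    · exact .inl ⟨m, h, .inl rfl⟩
    · exact .inl ⟨m, h, .inr rfl⟩
    · exact .inr ⟨_, _, ⟨m, h, .inl rfl⟩, ⟨m, h, .inr rfl⟩, by omega, by omega⟩
    · exact .inr ⟨_, _, ⟨x, hx, .inl rfl⟩, ⟨y, hy, .inl rfl⟩, by omega, by omega⟩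
    · exact .inr ⟨_, _, ⟨x, hx, .inr rfl⟩, ⟨y, hy, .inr rfl⟩, by omega, by omega⟩
    · exact .inr ⟨_, _, ⟨x, hx, .inl rfl⟩, ⟨y, hy, .inr rfl⟩, by omega, by omega⟩
  | two w ih =>
    simp only [top] at hz
    -- The digits 0 and 2 extend to the progression 0, 2, 4, so residue 1 is written as 4 with a
    -- borrow; z > 3 `top w` + 2 keeps m ≥ `top w`.
    obtain ⟨m, e, hm, rfl, he⟩ : ∃ m e, w.top ≤ m ∧ z = 3 * m + e ∧
        (e = 0 ∨ e = 2 ∨ e = 4) := by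
      obtain ⟨q, hq | hq | hq⟩ := exists_eq_three_mul_add z
      · exact ⟨q, 0, by omega, by omega, by omega⟩
      · exact ⟨q - 1, 4, by omega, by omega, by omega⟩
      · exact ⟨q, 2, by omega, by omega, by omega⟩
    have key : w.Term m ∨ ∃ x y, w.Term x ∧ w.Term y ∧ x < y ∧ x + m = y + y := by
      rcases hm.eq_or_lt with rfl | hlt
      exacts [.inl w.term_top, ih hw.1 hlt]
    rcases key with h | ⟨x, y, hx, hy, hlt, h⟩ <;> rcases he with rfl | rfl | rfl
    · exact .inl ⟨m, h, .inl rfl⟩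
    · exact .inl ⟨m, h, .inr rfl⟩
    · exact .inr ⟨_, _, ⟨m, h, .inl rfl⟩, ⟨m, h, .inr rfl⟩, by omega, by omega⟩
    · exact .inr ⟨_, _, ⟨x, hx, .inl rfl⟩, ⟨y, hy, .inl rfl⟩, by omega, by omega⟩
    · exact .inr ⟨_, _, ⟨x, hx, .inr rfl⟩, ⟨y, hy, .inr rfl⟩, by omega, by omega⟩
    · exact .inr ⟨_, _, ⟨x, hx, .inl rfl⟩, ⟨y, hy, .inr rfl⟩, by omega, by omega⟩

/-! ### Repetition of the terms under translation by 3 ^ k. -/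

/-- `top w` is below a third of 3 ^ k, and c is below a half. -/
theorem top_add_lt {w : DigitWord} {k c : ℕ} (hk : w.length < k) (hc : TernaryZeroOne c)
    (hck : c < 3 ^ k) : w.top + c < 3 ^ k := by
  have h1 := w.top_lt
  have h2 : 3 ^ (w.length + 1) ≤ 3 ^ k := Nat.pow_le_pow_right (by norm_num) hk
  have h3 := hc.two_mul_lt hck
  rw [pow_succ] at h2
  omega

/-- Beyond the word, the terms of `k` and of `k + 1` ternary digits differ by a shift. -/
theorem term_pow_add_iff {w : DigitWord} {k m : ℕ} (hk : w.length < k) (hm : m < 3 ^ k) :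
    w.Term (3 ^ k + m) ↔ w.Term m := by
  induction w generalizing k m with
  | nil =>
    have h := TernaryZeroOne.lt_pow_succ_iff (n := 3 ^ k + m) (k := k)
    simp only [Term]
    constructor
    · intro ht
      rcases h.1 ⟨ht, by rw [pow_succ]; omega⟩ with ⟨_, hlt⟩ | ⟨a, ha, _, e⟩
      · omega
      · obtain rfl : m = a := by omega
        exact ha
    · exact fun ht => (h.2 (.inr ⟨m, ht, hm, rfl⟩)).1
  | free w ih =>
    obtain ⟨k, rfl⟩ : ∃ l, k = l + 1 := ⟨k - 1, by omega⟩
    simp only [length, Nat.add_lt_add_iff_right] at hk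
    have e : 3 ^ (k + 1) = 3 * 3 ^ k := by ring
    simp only [Term]
    constructor
    · rintro (⟨a, ha, h⟩ | ⟨c, hc, h⟩)
      · obtain ⟨b, rfl⟩ : ∃ b, a = 3 ^ k + b := ⟨a - 3 ^ k, by omega⟩
        exact .inl ⟨b, (ih hk (by omega)).1 ha, by omega⟩
      · have hlt := top_add_lt (w := w) (k := k) hk hc
        rcases TernaryZeroOne.lt_pow_succ_iff (n := c) (k := k).1 ⟨hc, by omega⟩ with
          ⟨_, h'⟩ | ⟨b, hb, _, rfl⟩
        · have := hlt h'
          omega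
        · exact .inr ⟨b, hb, by omega⟩
    · rintro (⟨a, ha, h⟩ | ⟨c, hc, h⟩)
      · exact .inl ⟨3 ^ k + a, (ih hk (by omega)).2 ha, by omega⟩
      · exact .inr ⟨3 ^ k + c,
          (TernaryZeroOne.lt_pow_succ_iff.2 (.inr ⟨c, hc, by omega, rfl⟩)).1, by omega⟩
  | one w ih =>
    obtain ⟨k, rfl⟩ : ∃ l, k = l + 1 := ⟨k - 1, by omega⟩
    simp only [length, Nat.add_lt_add_iff_right] at hk
    have e : 3 ^ (k + 1) = 3 * 3 ^ k := by ring
    simp only [Term]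
    constructor
    · rintro ⟨a, ha, h⟩
      obtain ⟨b, rfl⟩ : ∃ b, a = 3 ^ k + b := ⟨a - 3 ^ k, by omega⟩
      exact ⟨b, (ih hk (by omega)).1 ha, by omega⟩
    · rintro ⟨a, ha, h⟩
      exact ⟨3 ^ k + a, (ih hk (by omega)).2 ha, by omega⟩
  | two w ih =>
    obtain ⟨k, rfl⟩ : ∃ l, k = l + 1 := ⟨k - 1, by omega⟩
    simp only [length, Nat.add_lt_add_iff_right] at hk
    have e : 3 ^ (k + 1) = 3 * 3 ^ k := by ring
    simp only [Term]
    constructor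
    · rintro ⟨a, ha, h⟩
      obtain ⟨b, rfl⟩ : ∃ b, a = 3 ^ k + b := ⟨a - 3 ^ k, by omega⟩
      exact ⟨b, (ih hk (by omega)).1 ha, by omega⟩
    · rintro ⟨a, ha, h⟩
      exact ⟨3 ^ k + a, (ih hk (by omega)).2 ha, by omega⟩

theorem term_pow {w : DigitWord} {k : ℕ} (hk : w.length < k) : w.Term (3 ^ k) := by
  simpa using (term_pow_add_iff (m := 0) hk (by positivity)).2 w.term_zero

theorem infinite_term (w : DigitWord) : {n | w.Term n}.Infinite := by
  refine Set.infinite_of_forall_exists_gt fun a => ⟨3 ^ (a + w.length + 1), term_pow (by omega), ?_⟩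
  exact (by omega : a < a + w.length + 1).trans (Nat.lt_pow_self (by norm_num))

end DigitWord

/-! ### Counting the terms below 3 ^ k. -/

open Classical in
theorem count_congr_of_lt {p q : ℕ → Prop} {n : ℕ} (h : ∀ m < n, p m ↔ q m) :
    Nat.count p n = Nat.count q n :=
  le_antisymm (Nat.count_mono_left fun m hm => (h m hm).1)
    (Nat.count_mono_left fun m hm => (h m hm).2)

open Classical in
theorem count_three_mul (p : ℕ → Prop) (n : ℕ) :
    Nat.count p (3 * n) = Nat.count (fun m => p (3 * m)) n +
      Nat.count (fun m => p (3 * m + 1)) n + Nat.count (fun m => p (3 * m + 2)) n := by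
  induction n with
  | zero => simp
  | succ n ih =>
    rw [show 3 * (n + 1) = 3 * n + 1 + 1 + 1 by ring]
    simp only [Nat.count_succ, ih]
    ring

open Classical in
theorem count_ternaryZeroOne (k : ℕ) : Nat.count TernaryZeroOne (3 ^ k) = 2 ^ k := by
  induction k with
  | zero => rw [pow_zero, Nat.count_one, if_pos .zero, pow_zero]
  | succ k ih =>
    rw [pow_succ', count_three_mul]
    simp only [TernaryZeroOne.three_mul_iff, TernaryZeroOne.three_mul_add_one_iff,
      TernaryZeroOne.not_three_mul_add_two, Nat.count_false]
    rw [show Nat.count (fun m => TernaryZeroOne m) (3 ^ k) = 2 ^ k from ih, pow_succ]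
    ring

namespace DigitWord

open Classical in
theorem count_term (w : DigitWord) {k : ℕ} (hk : w.length < k) :
    Nat.count w.Term (3 ^ k) = 2 ^ k := by
  induction w generalizing k with
  | nil => exact count_ternaryZeroOne k
  | free w ih =>
    obtain ⟨k, rfl⟩ : ∃ l, k = l + 1 := ⟨k - 1, by omega⟩
    simp only [length, Nat.add_lt_add_iff_right] at hk
    have h0 : ∀ m < 3 ^ k, w.free.Term (3 * m) ↔ w.Term m := by
      intro m _
      constructor
      · rintro (⟨a, ha, h⟩ | ⟨c, hc, h⟩)
        · obtain rfl : m = a := by omega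
          exact ha
        · omega
      · exact fun h => .inl ⟨m, h, rfl⟩
    have h2 : ∀ m < 3 ^ k, ¬ w.free.Term (3 * m + 2) := by
      intro m _
      rintro (⟨a, ha, h⟩ | ⟨c, hc, h⟩) <;> omega
    have h1 : Nat.count (fun m => w.free.Term (3 * m + 1)) (3 ^ k) = 2 ^ k := by
      have ht : w.top ≤ 3 ^ k := (top_add_lt hk .zero (by positivity)).le
      have hsplit : 3 ^ k = w.top + (3 ^ k - w.top) := by omega
      have hlow : Nat.count (fun m => w.free.Term (3 * m + 1)) w.top = 0 := by
        rw [Nat.count_iff_forall_not]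
        rintro m hm (⟨a, ha, h⟩ | ⟨c, hc, h⟩) <;> omega
      have hhigh : ∀ m < 3 ^ k - w.top,
          w.free.Term (3 * (w.top + m) + 1) ↔ TernaryZeroOne m := by
        intro m _
        constructor
        · rintro (⟨a, ha, h⟩ | ⟨c, hc, h⟩)
          · omega
          · obtain rfl : m = c := by omega
            exact hc
        · exact fun h => .inr ⟨m, h, rfl⟩
      -- Translation by `w.top` pushes no number with digits 0 and 1 past 3 ^ k, so the count is
      -- unchanged.
      have hend : Nat.count (fun m => TernaryZeroOne (3 ^ k - w.top + m)) w.top = 0 := by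
        rw [Nat.count_iff_forall_not]
        intro m hm h
        have := top_add_lt hk h (by omega)
        omega
      have htot := count_ternaryZeroOne k
      rw [show 3 ^ k = (3 ^ k - w.top) + w.top by omega, Nat.count_add, hend] at htot
      rw [hsplit, Nat.count_add, hlow, count_congr_of_lt hhigh, zero_add]
      exact htot
    rw [pow_succ', count_three_mul, count_congr_of_lt h0, Nat.count_iff_forall_not.2 h2, h1,
      ih hk, pow_succ]
    ring
  | one w ih =>
    obtain ⟨k, rfl⟩ : ∃ l, k = l + 1 := ⟨k - 1, by omega⟩
    simp only [length, Nat.add_lt_add_iff_right] at hk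
    have h0 : ∀ m < 3 ^ k, w.one.Term (3 * m) ↔ w.Term m := by
      refine fun m _ => ⟨?_, fun h => ⟨m, h, .inl rfl⟩⟩
      rintro ⟨a, ha, h⟩
      obtain rfl : m = a := by omega
      exact ha
    have h1 : ∀ m < 3 ^ k, w.one.Term (3 * m + 1) ↔ w.Term m := by
      refine fun m _ => ⟨?_, fun h => ⟨m, h, .inr rfl⟩⟩
      rintro ⟨a, ha, h⟩
      obtain rfl : m = a := by omega
      exact ha
    have h2 : ∀ m < 3 ^ k, ¬ w.one.Term (3 * m + 2) := by
      intro m _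
      rintro ⟨a, ha, h⟩
      omega
    rw [pow_succ', count_three_mul, count_congr_of_lt h0, count_congr_of_lt h1,
      Nat.count_iff_forall_not.2 h2, ih hk, pow_succ]
    ring
  | two w ih =>
    obtain ⟨k, rfl⟩ : ∃ l, k = l + 1 := ⟨k - 1, by omega⟩
    simp only [length, Nat.add_lt_add_iff_right] at hk
    have h0 : ∀ m < 3 ^ k, w.two.Term (3 * m) ↔ w.Term m := by
      refine fun m _ => ⟨?_, fun h => ⟨m, h, .inl rfl⟩⟩
      rintro ⟨a, ha, h⟩
      obtain rfl : m = a := by omega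
      exact ha
    have h1 : ∀ m < 3 ^ k, ¬ w.two.Term (3 * m + 1) := by
      intro m _
      rintro ⟨a, ha, h⟩
      omega
    have h2 : ∀ m < 3 ^ k, w.two.Term (3 * m + 2) ↔ w.Term m := by
      refine fun m _ => ⟨?_, fun h => ⟨m, h, .inr rfl⟩⟩
      rintro ⟨a, ha, h⟩
      obtain rfl : m = a := by omega
      exact ha
    rw [pow_succ', count_three_mul, count_congr_of_lt h0,
      Nat.count_iff_forall_not.2 h1, count_congr_of_lt h2, ih hk, pow_succ]
    ring

theorem nth_two_pow {w : DigitWord} {k : ℕ} (hk : w.length < k) :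
    Nat.nth w.Term (2 ^ k) = 3 ^ k := by
  classical
  rw [← count_term w hk, Nat.nth_count (term_pow hk)]

theorem nth_two_pow_add {w : DigitWord} {k i : ℕ} (hk : w.length < k) (hi : i < 2 ^ k) :
    Nat.nth w.Term (2 ^ k + i) = 3 ^ k + Nat.nth w.Term i := by
  classical
  have hmem : w.Term (Nat.nth w.Term i) := Nat.nth_mem_of_infinite w.infinite_term i
  have hlt : Nat.nth w.Term i < 3 ^ k := Nat.nth_lt_of_lt_count (by rwa [count_term w hk])
  have hcount : Nat.count w.Term (3 ^ k + Nat.nth w.Term i) = 2 ^ k + i := by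
    rw [Nat.count_add, count_term w hk,
      count_congr_of_lt fun m hm => term_pow_add_iff hk (hm.trans hlt),
      Nat.count_nth_of_infinite w.infinite_term]
  rw [← hcount, Nat.nth_count ((term_pow_add_iff hk hlt).2 hmem)]

end DigitWord

/-! ### The greedy sequence and its independence. -/

/-- A greedy sequence is determined by a 3-free set that extends the initial set and in which every
later gap completes an arithmetic progression. -/
theorem stanleySeq_eq_nth {A : Finset ℕ} {p : ℕ → Prop} {d : ℕ} (hinf : {n | p n}.Infinite)
    (hfree : ThreeAPFree {n | p n}) (hA : ∀ n, n ∈ A ↔ p n ∧ n ≤ d) (hd : p d)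
    (hcover : ∀ z, d < z → ¬ p z → ∃ x y, p x ∧ p y ∧ x < y ∧ x + z = y + y) (n : ℕ) :
    stanleySeq A n = Nat.nth p n := by
  classical
  have hcard : A.card = Nat.count p (d + 1) := by
    rw [Nat.count_eq_card_filter_range]
    congr 1
    ext m
    rw [hA, Finset.mem_filter, Finset.mem_range, Nat.lt_succ_iff, and_comm]
  induction n using Nat.strong_induction_on with
  | _ n ih =>
    rw [stanleySeq]
    split_ifs with h
    · have := Finset.orderEmbOfFin_unique (s := A) rfl (f := fun i => Nat.nth p i)
        (fun i => (hA _).2 ⟨Nat.nth_mem_of_infinite hinf _, Nat.lt_succ_iff.1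
          (Nat.nth_lt_of_lt_count (hcard ▸ i.2))⟩)
        (fun i j hij => Nat.nth_strictMono hinf hij)
      exact (congrFun this ⟨n, h⟩).symm
    · have hseq : ∀ m : Fin n, stanleySeq A m = Nat.nth p m := fun m => ih m m.2
      simp only [hseq]
      refine IsLeast.csInf_eq ⟨⟨fun m => Nat.nth_strictMono hinf m.2, ?_⟩, ?_⟩
      · refine hfree.mono ?_
        rintro x (rfl | ⟨m, rfl⟩) <;> exact Nat.nth_mem_of_infinite hinf _
      · rintro x ⟨hgt, hx⟩
        by_contra! hlt
        have hrange : ∀ y, p y → y < Nat.nth p n →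
            y ∈ Set.range fun m : Fin n => Nat.nth p m := by
          intro y hy hyn
          exact ⟨⟨Nat.count p y, by
            simpa [Nat.count_nth_of_infinite hinf] using Nat.count_strict_mono hy hyn⟩,
            Nat.nth_count hy⟩
        by_cases hpx : p x
        · obtain ⟨m, hm⟩ := hrange x hpx hlt
          exact (hgt m).ne hm
        -- d is itself among the first n terms, all of which x exceeds.
        · have hdx : d < x := by
            have hdn : Nat.count p d < n := by
              rw [Nat.count_succ, if_pos hd] at hcard
              omega
            simpa [Nat.nth_count hd] using hgt ⟨_, hdn⟩
          obtain ⟨a, b, ha, hb, hab, he⟩ := hcover x hdx hpx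
          have := hx (.inr (hrange a ha (by omega))) (.inr (hrange b hb (by omega)))
            (.inl rfl) he
          omega

namespace DigitWord

theorem isIndependentStanley {w : DigitWord} (hw : w.Admissible) {A : Finset ℕ}
    (hA : ∀ n, n ∈ A ↔ w.Gen n) : IsIndependentStanley A := by
  have hA' : ∀ n, n ∈ A ↔ w.Term n ∧ n ≤ w.top := fun n => (hA n).trans (gen_iff w n)
  have hseq := stanleySeq_eq_nth w.infinite_term w.threeAPFree_term hA' w.term_top
    fun z hz hp => (term_or_exists_progression w hw hz).resolve_left hp
  -- The constant is fixed by the equation at exponent `w.length + 1`. Passing from k to k + 1 adds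
  -- 2 · 3 ^ k to both sides, so it stays valid.
  refine ⟨⟨_, (hA _).2 w.gen_top⟩, w.threeAPFree_term.mono fun n hn => ((hA' n).1 hn).1,
    2 * (Nat.nth w.Term (2 ^ (w.length + 1) - 1) : ℤ) - 3 ^ (w.length + 1) + 1, w.length + 1,
    fun k hk => ?_⟩
  simp only [hseq]
  refine ⟨fun i hi => by rw [nth_two_pow_add hk hi, nth_two_pow hk], ?_⟩
  rw [nth_two_pow hk]
  induction k, hk using Nat.le_induction with
  | base => push_cast; ring
  | succ k hk ih =>
    have hpos : 0 < 2 ^ k := by positivity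
    rw [show 2 ^ (k + 1) - 1 = 2 ^ k + (2 ^ k - 1) by rw [pow_succ]; omega,
      nth_two_pow_add hk (by omega)]
    push_cast at ih ⊢
    rw [pow_succ]
    linarith

end DigitWord

/-! ### Translating the digit sets into words. -/

/-- The set of all `t` with `t + 1 ∈ T`. -/
noncomputable def shiftDown (T : Finset ℕ) : Finset ℕ :=
  T.preimage (· + 1) (add_left_injective 1).injOn

@[simp]
theorem mem_shiftDown {T : Finset ℕ} {t : ℕ} : t ∈ shiftDown T ↔ t + 1 ∈ T := by
  simp [shiftDown]

theorem sum_three_pow_eq (U : Finset ℕ) :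
    ∑ a ∈ U, 3 ^ a = 3 * ∑ a ∈ shiftDown U, 3 ^ a + if 0 ∈ U then 1 else 0 := by
  have h : ∑ a ∈ U.erase 0, 3 ^ a = 3 * ∑ a ∈ shiftDown U, 3 ^ a := by
    have : U.erase 0 = (shiftDown U).map (addRightEmbedding 1) := by
      ext a
      rcases a with _ | a <;> simp
    rw [this, Finset.sum_map, Finset.mul_sum]
    exact Finset.sum_congr rfl fun a _ => by simp [pow_succ']
  rw [← h]
  split_ifs with h0
  · rw [← Finset.sum_erase_add _ _ h0, pow_zero]
  · rw [Finset.erase_eq_of_notMem h0, add_zero]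

theorem exists_shiftDown_eq (U : Finset ℕ) :
    ∃ W : Finset ℕ, shiftDown W = U ∧ 0 ∉ W ∧ shiftDown (insert 0 W) = U := by
  refine ⟨U.map (addRightEmbedding 1), ?_, ?_, ?_⟩
  · ext; simp
  · simp
  · ext; simp

theorem mem_ternaryDigitSet {T₁ T₂ : Finset ℕ} {n : ℕ} : n ∈ ternaryDigitSet T₁ T₂ ↔
    ∃ U ⊆ T₁, ∃ V ⊆ T₂, ∑ a ∈ U, 3 ^ a + 2 * ∑ b ∈ V, 3 ^ b = n := by
  simp [ternaryDigitSet, and_assoc]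

theorem shiftDown_mono {U T : Finset ℕ} (h : U ⊆ T) : shiftDown U ⊆ shiftDown T := by
  intro t ht
  rw [mem_shiftDown] at ht ⊢
  exact h ht

theorem exists_subset_shiftDown_eq {U T : Finset ℕ} (h : U ⊆ shiftDown T) :
    (∃ W ⊆ T, shiftDown W = U ∧ 0 ∉ W) ∧ (0 ∈ T → ∃ W ⊆ T, shiftDown W = U ∧ 0 ∈ W) := by
  obtain ⟨W, hW, h0, hW'⟩ := exists_shiftDown_eq U
  have hsub : W ⊆ T := by
    intro t ht
    rcases t with _ | t
    · exact absurd ht h0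
    · exact mem_shiftDown.1 (h (hW ▸ mem_shiftDown.2 ht))
  exact ⟨⟨W, hsub, hW, h0⟩, fun hT =>
    ⟨insert 0 W, Finset.insert_subset hT hsub, hW', Finset.mem_insert_self _ _⟩⟩

/-- The lowest ternary digit of the elements of `ternaryDigitSet`. -/
theorem mem_ternaryDigitSet_iff_shiftDown {T₁ T₂ : Finset ℕ} {n : ℕ} :
    n ∈ ternaryDigitSet T₁ T₂ ↔ ∃ m ∈ ternaryDigitSet (shiftDown T₁) (shiftDown T₂),
      n = 3 * m ∨ (0 ∈ T₁ ∧ n = 3 * m + 1) ∨ (0 ∈ T₂ ∧ n = 3 * m + 2) ∨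
        (0 ∈ T₁ ∧ 0 ∈ T₂ ∧ n = 3 * m + 3) := by
  simp only [mem_ternaryDigitSet]
  constructor
  · rintro ⟨U, hU, V, hV, rfl⟩
    refine ⟨_, ⟨_, shiftDown_mono hU, _, shiftDown_mono hV, rfl⟩, ?_⟩
    rw [sum_three_pow_eq U, sum_three_pow_eq V]
    split_ifs with h1 h2 h2
    · exact .inr (.inr (.inr ⟨hU h1, hV h2, by ring⟩))
    · exact .inr (.inl ⟨hU h1, by ring⟩)
    · exact .inr (.inr (.inl ⟨hV h2, by ring⟩))
    · exact .inl (by ring)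
  · rintro ⟨_, ⟨U, hU, V, hV, rfl⟩, h⟩
    obtain ⟨⟨U₀, hU₀, rfl, hU₀'⟩, hU₁⟩ := exists_subset_shiftDown_eq hU
    obtain ⟨⟨V₀, hV₀, hV₀e, hV₀'⟩, hV₁⟩ := exists_subset_shiftDown_eq hV
    rcases h with rfl | ⟨h1, rfl⟩ | ⟨h2, rfl⟩ | ⟨h1, h2, rfl⟩
    · refine ⟨U₀, hU₀, V₀, hV₀, ?_⟩
      rw [sum_three_pow_eq U₀, sum_three_pow_eq V₀, if_neg hU₀', if_neg hV₀', hV₀e]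
      ring
    · obtain ⟨U₁, hU₁, hU₁e, hU₁'⟩ := hU₁ h1
      refine ⟨U₁, hU₁, V₀, hV₀, ?_⟩
      rw [sum_three_pow_eq U₁, sum_three_pow_eq V₀, if_pos hU₁', if_neg hV₀', hV₀e, hU₁e]
      ring
    · obtain ⟨V₁, hV₁, hV₁e, hV₁'⟩ := hV₁ h2
      refine ⟨U₀, hU₀, V₁, hV₁, ?_⟩
      rw [sum_three_pow_eq U₀, sum_three_pow_eq V₁, if_neg hU₀', if_pos hV₁', hV₁e]
      ring
    · obtain ⟨U₁, hU₁, hU₁e, hU₁'⟩ := hU₁ h1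
      obtain ⟨V₁, hV₁, hV₁e, hV₁'⟩ := hV₁ h2
      refine ⟨U₁, hU₁, V₁, hV₁, ?_⟩
      rw [sum_three_pow_eq U₁, sum_three_pow_eq V₁, if_pos hU₁', if_pos hV₁', hV₁e, hU₁e]
      ring

namespace DigitWord

open Classical in
/-- The word of length `m` that marks the elements of `T₁` by `one` and those of `T₂` by `two`. -/
noncomputable def ofSets : ℕ → Finset ℕ → Finset ℕ → DigitWord
  | 0, _, _ => nil
  | m + 1, T₁, T₂ =>
    if 0 ∈ T₁ then one (ofSets m (shiftDown T₁) (shiftDown T₂))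
    else if 0 ∈ T₂ then two (ofSets m (shiftDown T₁) (shiftDown T₂))
    else free (ofSets m (shiftDown T₁) (shiftDown T₂))

theorem zero_mem_of_startsWithOne {m : ℕ} {T₁ T₂ : Finset ℕ}
    (h : (ofSets m T₁ T₂).StartsWithOne) : 0 ∈ T₁ := by
  rcases m with _ | m
  · exact h.elim
  · rw [ofSets] at h
    split_ifs at h with h1 h2
    exacts [h1, h.elim, h.elim]

theorem admissible_ofSets {m : ℕ} {T₁ T₂ : Finset ℕ} (h : ∀ s ∈ T₂, s + 1 ∉ T₁) :
    (ofSets m T₁ T₂).Admissible := by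
  induction m generalizing T₁ T₂ with
  | zero => trivial
  | succ m ih =>
    have h' : (ofSets m (shiftDown T₁) (shiftDown T₂)).Admissible :=
      ih fun s hs => by simpa using h (s + 1) (mem_shiftDown.1 hs)
    rw [ofSets]
    split_ifs with h1 h2
    · exact h'
    · exact ⟨h', fun hs => h 0 h2 (mem_shiftDown.1 (zero_mem_of_startsWithOne hs))⟩
    · exact h'

theorem mem_ternaryDigitSet_iff_gen {m : ℕ} {T₁ T₂ : Finset ℕ} (h₁ : T₁ ⊆ Finset.range m)
    (h₂ : T₂ ⊆ Finset.range m) (hd : Disjoint T₁ T₂) (n : ℕ) :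
    n ∈ ternaryDigitSet T₁ T₂ ↔ (ofSets m T₁ T₂).Gen n := by
  induction m generalizing T₁ T₂ n with
  | zero =>
    obtain rfl : T₁ = ∅ := by simpa using h₁
    obtain rfl : T₂ = ∅ := by simpa using h₂
    simp [ternaryDigitSet, ofSets, Gen]
  | succ m ih =>
    have hsub : ∀ T : Finset ℕ, T ⊆ Finset.range (m + 1) → shiftDown T ⊆ Finset.range m := by
      intro T hT t ht
      simpa using hT (mem_shiftDown.1 ht)
    have hd' : Disjoint (shiftDown T₁) (shiftDown T₂) := by
      rw [Finset.disjoint_left] at hd ⊢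
      exact fun t ht ht' => hd (mem_shiftDown.1 ht) (mem_shiftDown.1 ht')
    rw [mem_ternaryDigitSet_iff_shiftDown, ofSets]
    simp only [ih (hsub _ h₁) (hsub _ h₂) hd']
    split_ifs with h1 h2
    -- Disjointness rules out the lowest contribution 1 + 2 = 3, which would carry.
    · have h2 : 0 ∉ T₂ := Finset.disjoint_left.1 hd h1
      simp [Gen, h1, h2]
    · simp [Gen, h1, h2]
    · simp [Gen, h1, h2]

end DigitWord

theorem theorem3 (k : ℕ) (hk : 0 < k) (T₁ T₂ : Finset ℕ)
    (hT₁ : T₁ ⊆ Finset.range (k + 1)) (hT₂ : T₂ ⊆ Finset.range (k + 1))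
    (hdisj : Disjoint T₁ T₂)
    (hpred : ∀ t ∈ T₁, ∀ s ∈ T₂, (s : ℤ) ≠ (t : ℤ) - 1) :
    IsIndependentStanley (ternaryDigitSet T₁ T₂) :=
  DigitWord.isIndependentStanley
    (DigitWord.admissible_ofSets (m := k + 1) fun s hs ht => hpred _ ht s hs (by push_cast; ring))
    (DigitWord.mem_ternaryDigitSet_iff_gen hT₁ hT₂ hdisj)
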